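/- **Setting.** There are $n\ge 1$ agents and a finite set $\mathcal M$ of $m$ indivisible items; agent $i$ has value $v_i(g)\ge 0$ for item $g$ and $v_i(S)=\sum_{g\in S}v_i(g)$. An allocation of $S\subseteq\mathcal M$ is an ordered partition $X=(X_1,\dots,X_n)$ of $S$ (empty bundles allowed), $\mathrm{NW}(X)=\bigl(\prod_i v_i(X_i)\bigr)^{1/n}$, and $\mathrm{opt}(\mathcal M)$ is the maximum of $\mathrm{NW}$ over all allocations of $\mathcal M$. $X$ is $\alpha$-efficient if $\alpha\,\mathrm{NW}(X)\ge\mathrm{opt}(\mathcal M)$. Write $d_i(B)=\max_{g\in B}v_i(B\setminus\{g\})$, with $d_i(\emptyset)=0$. $X$ is EFX if $v_i(X_i)\ge d_i(X_j)$ for all $i,j$. **Algorithm 2**, on input an allocation $X$ of $\mathcal M$ and $\delta$. Put $\delta_1=\frac{2\delta}{1-\delta}$ and $Z\gets X$. Repeat the following rounds. Let $G$ be the bipartite graph between agents and bundles $Z_1,\dots,Z_n$ that has the edge $(i,Z_j)$ iff $v_i(Z_j)\ge d_i(Z_k)$ for all $k$ and, if $i\ne j$, $v_i(Z_j)>v_i(Z_i)$.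 Choose a matching $M$ in $G$ such that (a) every touched bundle (every $Z_j\neq X_j$) is matched; (b) under (a), the number of edges of the form $(i,Z_i)$ in $M$ is maximum; (c) under (a) and (b), $|M|$ is maximum. If $|M|=n$, return the allocation $Y$ that gives each agent the bundle matched to her. Otherwise choose an unmatched bundle $Z_{j_1}$ and repeat the following until an item is removed. Let $j_1,\dots,j_k$ be the agents with $(j_i,Z_{j_{i+1}})\in M$ for $1\le i<k$ and $j_k$ unmatched in $M$, and choose a robust demand $Z_{j^*}$ of $j_k$, i.e. a bundle that maximizes $d_{j_k}$. If $j^*=j_{i+1}$ for some $1\le i<k$, replace the edge $(j_i,Z_{j^*})$ of $M$ by $(j_k,Z_{j^*})$. Otherwise remove from $Z_{j^*}$ an item of least value for $j_k$; if then $(2+\delta_1)v_{j^*}(Z_{j^*})<v_{j^*}(X_{j^*})$, stop and return the improved allocation $\widehat X$ given, with $j_{k+1}=j^*$, by $\widehat X_{j_1}=X_{j_1}\cup Z_{j_2}$, $\widehat X_{j_i}=(X_{j_i}\setminus Z_{j_i})\cup Z_{j_{i+1}}$ for $2\le i\le k$, $\widehat X_{j^*}=X_{j^*}\setminus Z_{j^*}$,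 and $\widehat X_a=X_a$ for all other agents $a$; if not, go to the next round. **Theorem 3.** There is an absolute constant $C$ such that the following holds. Let $X$ be a $\rho$-efficient allocation of $\mathcal M$ and $\delta=\frac1{2n+1}$. Run Algorithm 2 on $X$; whenever it returns an improved allocation $\widehat X$, run it again with input $\widehat X$. Then, no matter how the free choices in the algorithm are made: 1. The procedure never gets stuck and stops after finitely many steps, when an execution returns an allocation $Y$ of some subset of $\mathcal M$ as its EFX allocation. 2. Every improved allocation $\widehat X$ returned on the way, by an execution with input $X'$, is an allocation of $\mathcal M$ with $\mathrm{NW}(\widehat X)\ge(1+\delta)^{1/n}\,\mathrm{NW}(X')$. 3. The returned allocation $Y$ is EFX and $2\rho$-efficient. 4. If $\mathrm{opt}(\mathcal M)>0$, there are at most $C\rho n^2$ executions of Algorithm 2; that is, $O(n^2)$ for fixed $\rho$. -/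

import Mathlib

namespace FairDivision

/-! Agents are the elements of `Fin n`, items are the elements of `Fin m`, and `v i g` is the value
of item `g` for agent `i`.  A family of bundles indexed by agents is a `Bundles n m`. -/

/-- An ordered family of `n` bundles of items. -/
abbrev Bundles (n m : ℕ) : Type := Fin n → Finset (Fin m)

noncomputable section

/-- Additive valuation: the value of the bundle `B` for agent `i`. -/
def val {n m : ℕ} (v : Fin n → Fin m → ℝ) (i : Fin n) (B : Finset (Fin m)) : ℝ :=
  ∑ g ∈ B, v i g

/-- `X` is an allocation of the item set `S` (an ordered partition of `S` in `n` bundles, which may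
be empty). -/
def IsAllocation {n m : ℕ} (S : Finset (Fin m)) (X : Bundles n m) : Prop :=
  (∀ i j, i ≠ j → Disjoint (X i) (X j)) ∧ Finset.univ.biUnion X = S

/-- `max_{g ∈ B} v_i(B - {g})`, which is `0` if `B` is empty. -/
def maxDrop {n m : ℕ} (v : Fin n → Fin m → ℝ) (i : Fin n) (B : Finset (Fin m)) : ℝ :=
  if h : B.Nonempty then B.sup' h (fun g => val v i (B.erase g)) else 0

/-- Envy-freeness up to any item. -/
def IsEFX {n m : ℕ} (v : Fin n → Fin m → ℝ) (X : Bundles n m) : Prop :=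
  ∀ i j, maxDrop v i (X j) ≤ val v i (X i)

/-- Nash welfare: the geometric mean of the agents' values. -/
def NW {n m : ℕ} (v : Fin n → Fin m → ℝ) (X : Bundles n m) : ℝ :=
  (∏ i, val v i (X i)) ^ ((1 : ℝ) / n)

/-- The maximum Nash welfare over all allocations of `S`.  For `n ≥ 1` the set below is finite and
non-empty, so that the supremum is a maximum. -/
def opt {n m : ℕ} (v : Fin n → Fin m → ℝ) (S : Finset (Fin m)) : ℝ :=
  sSup {w : ℝ | ∃ X : Bundles n m, IsAllocation S X ∧ w = NW v X}

/-- `α`-efficiency; the benchmark is the optimum for the set of all items. -/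
def IsEfficient {n m : ℕ} (v : Fin n → Fin m → ℝ) (α : ℝ) (X : Bundles n m) : Prop :=
  opt v Finset.univ ≤ α * NW v X

/-! ### The EFX feasibility graph and its matchings

The bundle `Z j` is represented, as a vertex, by its index `j`.  A set of edges is a finite set of
pairs `(agent, bundle index)`. -/

/-- The edge between agent `i` and bundle `Z j` is in the EFX feasibility graph. -/
def IsEdge {n m : ℕ} (v : Fin n → Fin m → ℝ) (Z : Bundles n m) (i j : Fin n) : Prop :=
  (∀ k, maxDrop v i (Z k) ≤ val v i (Z j)) ∧ (i ≠ j → val v i (Z i) < val v i (Z j))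

/-- `M` is a matching in the EFX feasibility graph of `Z`. -/
def IsMatching {n m : ℕ} (v : Fin n → Fin m → ℝ) (Z : Bundles n m)
    (M : Finset (Fin n × Fin n)) : Prop :=
  (∀ e ∈ M, IsEdge v Z e.1 e.2) ∧
    ∀ e ∈ M, ∀ f ∈ M, (e.1 = f.1 ∨ e.2 = f.2) → e = f

/-- `M` is a matching that satisfies (a): every touched bundle (one that has lost an item since it
was the bundle `X j` of the input allocation) is matched. -/
def CoversTouched {n m : ℕ} (v : Fin n → Fin m → ℝ) (X Z : Bundles n m)
    (M : Finset (Fin n × Fin n)) : Prop :=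
  IsMatching v Z M ∧ ∀ j, Z j ≠ X j → ∃ i, (i, j) ∈ M

/-- The number of edges that `M` shares with the matching `{(i, Z i)}`. -/
def idCount {n : ℕ} (M : Finset (Fin n × Fin n)) : ℕ :=
  (M.filter (fun e => e.1 = e.2)).card

/-- `M` satisfies (a) and (b): under (a), the number of edges `(i, Z i)` is maximum. -/
def MaxIdentity {n m : ℕ} (v : Fin n → Fin m → ℝ) (X Z : Bundles n m)
    (M : Finset (Fin n × Fin n)) : Prop :=
  CoversTouched v X Z M ∧ ∀ M', CoversTouched v X Z M' → idCount M' ≤ idCount M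

/-- `M` satisfies (a), (b) and (c): under (a) and (b), the size is maximum. -/
def IsChosenMatching {n m : ℕ} (v : Fin n → Fin m → ℝ) (X Z : Bundles n m)
    (M : Finset (Fin n × Fin n)) : Prop :=
  MaxIdentity v X Z M ∧ ∀ M', MaxIdentity v X Z M' → M'.card ≤ M.card

/-- The bundle `Z j` is a robust demand of agent `i`. -/
def IsRobustDemand {n m : ℕ} (v : Fin n → Fin m → ℝ) (Z : Bundles n m) (i j : Fin n) : Prop :=
  ∀ k, maxDrop v i (Z k) ≤ maxDrop v i (Z j)

/-- `c` is an item of `B` of least value for agent `i`. -/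
def IsLeastItem {n m : ℕ} (v : Fin n → Fin m → ℝ) (i : Fin n) (B : Finset (Fin m))
    (c : Fin m) : Prop :=
  c ∈ B ∧ ∀ g ∈ B, v i c ≤ v i g

/-- `j 1, …, j k` are the agents, in order, of the augmenting path of `M ∪ {(i, Z i)}` that starts
at the bundle `Z (j 1)` and ends at an agent unmatched in `M`: it uses the edges
`(j i, Z (j i))` for `1 ≤ i ≤ k` and the edges `(j i, Z (j (i + 1)))` of `M` for `1 ≤ i < k`.
The values of `j` outside `1, …, k` play no role. -/
structure IsAugmentingPath {n : ℕ} (M : Finset (Fin n × Fin n)) (k : ℕ) (j : ℕ → Fin n) :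
    Prop where
  one_le : 1 ≤ k
  start_unmatched : ∀ i, (i, j 1) ∉ M
  edges : ∀ i, 1 ≤ i → i < k → (j i, j (i + 1)) ∈ M
  simple : Set.InjOn j (Set.Icc 1 k)
  end_unmatched : ∀ b, (j k, b) ∉ M

/-- The improved allocation `Xh`, built from the input allocation `X`, the current bundles `Z`, the
agents `j 1, …, j k` of an augmenting path and the agent `j (k + 1)` whose bundle has just lost an
item. -/
structure IsReallocation {n m : ℕ} (X Z : Bundles n m) (k : ℕ) (j : ℕ → Fin n)
    (Xh : Bundles n m) : Prop where
  first : Xh (j 1) = X (j 1) ∪ Z (j 2)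
  middle : ∀ i, 2 ≤ i → i ≤ k → Xh (j i) = (X (j i) \ Z (j i)) ∪ Z (j (i + 1))
  last : Xh (j (k + 1)) = X (j (k + 1)) \ Z (j (k + 1))
  rest : ∀ a, (∀ i, 1 ≤ i → i ≤ k + 1 → j i ≠ a) → Xh a = X a

/-! ### The algorithm as a (nondeterministic) transition system -/

/-- Control states of one execution. -/
inductive State (n m : ℕ) : Type
  /-- The head of the outer loop, with current bundles `Z`. -/
  | outer (Z : Bundles n m) : State n m
  /-- The head of the inner loop, with current bundles `Z`, current matching `M` and the chosen
  unmatched bundle `Z j₁`. -/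
  | inner (Z : Bundles n m) (M : Finset (Fin n × Fin n)) (j₁ : Fin n) : State n m
  /-- The execution has returned the allocation `Y` of some of the items. -/
  | returnedEFX (Y : Bundles n m) : State n m
  /-- The execution has returned the improved allocation `Xh` of all the items. -/
  | returnedImproved (Xh : Bundles n m) : State n m

/-- The bundles after item `c` has been removed from bundle `s`. -/
def removeItem {n m : ℕ} (Z : Bundles n m) (s : Fin n) (c : Fin m) : Bundles n m :=
  Function.update Z s ((Z s).erase c)

/-- The parameter `δ₁ = 2δ / (1 - δ)`. -/
def delta₁ (δ : ℝ) : ℝ := 2 * δ / (1 - δ)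

/-- One step of an execution with input allocation `X` and parameter `δ`.  Every choice that the
algorithm leaves open (matching, unmatched bundle, ties) is a choice between possible steps.  In
the last three rules, `j (k + 1)` is the agent `j*` whose bundle is the robust demand of `j k`. -/
inductive Step {n m : ℕ} (v : Fin n → Fin m → ℝ) (δ : ℝ) (X : Bundles n m) :
    State n m → State n m → Prop
  /-- The matching is perfect: return the bundles matched to the agents. -/
  | finish (Z : Bundles n m) (M : Finset (Fin n × Fin n)) (Y : Bundles n m)
      (hM : IsChosenMatching v X Z M) (hcard : M.card = n)
      (hY : ∀ e ∈ M, Y e.1 = Z e.2) :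
      Step v δ X (State.outer Z) (State.returnedEFX Y)
  /-- The matching is not perfect: choose an unmatched bundle and enter the inner loop. -/
  | enter (Z : Bundles n m) (M : Finset (Fin n × Fin n)) (j₁ : Fin n)
      (hM : IsChosenMatching v X Z M) (hj₁ : ∀ i, (i, j₁) ∉ M) :
      Step v δ X (State.outer Z) (State.inner Z M j₁)
  /-- The robust demand lies on the path, in the edge `(j i, Z (j (i + 1)))` of `M`: replace that
  edge. -/
  | modify (Z : Bundles n m) (M : Finset (Fin n × Fin n)) (k : ℕ) (j : ℕ → Fin n) (i : ℕ)
      (hP : IsAugmentingPath M k j) (hR : IsRobustDemand v Z (j k) (j (k + 1)))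
      (hi : 1 ≤ i) (hik : i < k) (hon : j (i + 1) = j (k + 1)) :
      Step v δ X (State.inner Z M (j 1))
        (State.inner Z (insert (j k, j (k + 1)) (M.erase (j i, j (k + 1)))) (j 1))
  /-- The robust demand does not lie on the path; after the removal of an item, the value of its
  original owner for it is too low: return the improved allocation. -/
  | improve (Z : Bundles n m) (M : Finset (Fin n × Fin n)) (k : ℕ) (j : ℕ → Fin n) (c : Fin m)
      (Xh : Bundles n m)
      (hP : IsAugmentingPath M k j) (hR : IsRobustDemand v Z (j k) (j (k + 1)))
      (hoff : ¬ ∃ i, 1 ≤ i ∧ i < k ∧ j (i + 1) = j (k + 1))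
      (hc : IsLeastItem v (j k) (Z (j (k + 1))) c)
      (hlow : (2 + delta₁ δ) * val v (j (k + 1)) (removeItem Z (j (k + 1)) c (j (k + 1)))
        < val v (j (k + 1)) (X (j (k + 1))))
      (hXh : IsReallocation X (removeItem Z (j (k + 1)) c) k j Xh) :
      Step v δ X (State.inner Z M (j 1)) (State.returnedImproved Xh)
  /-- As before, but the value is not too low: go to the next round. -/
  | remove (Z : Bundles n m) (M : Finset (Fin n × Fin n)) (k : ℕ) (j : ℕ → Fin n) (c : Fin m)
      (hP : IsAugmentingPath M k j) (hR : IsRobustDemand v Z (j k) (j (k + 1)))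
      (hoff : ¬ ∃ i, 1 ≤ i ∧ i < k ∧ j (i + 1) = j (k + 1))
      (hc : IsLeastItem v (j k) (Z (j (k + 1))) c)
      (hhigh : ¬ (2 + delta₁ δ) * val v (j (k + 1)) (removeItem Z (j (k + 1)) c (j (k + 1)))
        < val v (j (k + 1)) (X (j (k + 1)))) :
      Step v δ X (State.inner Z M (j 1)) (State.outer (removeItem Z (j (k + 1)) c))

/-! ### Repeated executions -/

/-- A configuration of the repeated procedure: the number of executions started so far, the input
allocation of the current execution, and the state of that execution. -/
structure Config (n m : ℕ) : Type where
  executions : ℕ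
  input : Bundles n m
  state : State n m

/-- The procedure starts the first execution on the allocation `X`. -/
def initial {n m : ℕ} (X : Bundles n m) : Config n m := ⟨1, X, State.outer X⟩

/-- A step of the repeated procedure: a step of the current execution, or, if that execution has
returned an improved allocation, the start of a new execution on it. -/
inductive RepeatStep {n m : ℕ} (v : Fin n → Fin m → ℝ) (δ : ℝ) : Config n m → Config n m → Prop
  | inside (t : ℕ) (X : Bundles n m) (s s' : State n m) (h : Step v δ X s s') :
      RepeatStep v δ ⟨t, X, s⟩ ⟨t, X, s'⟩
  | restart (t : ℕ) (X Xh : Bundles n m) :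
      RepeatStep v δ ⟨t, X, State.returnedImproved Xh⟩ ⟨t + 1, Xh, State.outer Xh⟩

/-- The configuration `r` occurs in some run of the repeated procedure started on `X`. -/
def Reachable {n m : ℕ} (v : Fin n → Fin m → ℝ) (δ : ℝ) (X : Bundles n m) (r : Config n m) :
    Prop :=
  Relation.ReflTransGen (RepeatStep v δ) (initial X) r

end

end FairDivision

/-!
A matching that gives every touched bundle to an agent exists in every round, and this drives the
whole argument.  Let `M` be a chosen matching, `a` an agent whom it leaves out and `b` a robust
demand of `a`.  By the maximality of the number of edges `(i, Z i)`, the agent `a` is not content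
with `Z a`, so that she strictly prefers `Z b`, even without its least item, to `Z a`
(`MaxIdentity.val_lt_maxDrop`).  Hence `(a, b)` is an edge, and by the maximality of the size `b` is
matched (`IsChosenMatching.exists_mem_of_isRobustDemand`).  Giving `b` to `a` therefore keeps the
matching a chosen one if `b` is on the augmenting path (`IsChosenMatching.rematch`), and after the
removal of an item it shows that the touched bundles can still all be matched
(`MaxIdentity.coversTouched_removeItem`).  The starting bundle of the path is unmatched, hence
untouched, and it differs from `b`; so some bundle is untouched at the head of every round.

If an execution returns bundles `Y`, then every agent likes her bundle at least as much as `Z i`, and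
`v_i(X_i) ≤ (2 + 1/n) v_i(Z_i)` with equality of the bundles for some `i`.  As
`(2 + 1/n)^(n-1) ≤ 2^n`, the loss of Nash welfare is at most a factor `2` (`RoundInv.prod_le`).
If it returns an improved allocation, then the first agent of the path doubles her value, the owner
of `b` keeps the fraction `(1 + δ₁)/(2 + δ₁) = (1 + δ)/2`, and nobody else loses
(`IsReallocation.isGain`), so that the product of the values grows by the factor `1 + δ`.

An execution is finite because each step removes an item or shortens the path (`rank`).  The number of
executions is finite because the values of the agents with positive value grow as above while the
set of these agents can only grow (`IsGain.potential_lt`); this covers the case that all Nash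
welfares are `0`.  If the optimum is positive, then `(1 + δ)^(t-1) ≤ ρ^n` for the number `t` of
executions, and the bound follows from `log (1 + δ) ≥ 1/(2n+2)` and `log ρ ≤ ρ - 1`
(`ConfigInv.executions_le`).
-/

namespace FairDivision

variable {n m : ℕ} {v : Fin n → Fin m → ℝ}

/-! ### Additive valuations -/

theorem val_nonneg (hv : ∀ i g, 0 ≤ v i g) (i : Fin n) (B : Finset (Fin m)) : 0 ≤ val v i B :=
  Finset.sum_nonneg fun g _ => hv i g

theorem val_mono (hv : ∀ i g, 0 ≤ v i g) (i : Fin n) {A B : Finset (Fin m)} (h : A ⊆ B) :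
    val v i A ≤ val v i B :=
  Finset.sum_le_sum_of_subset_of_nonneg h fun g _ _ => hv i g

theorem val_union (i : Fin n) {A B : Finset (Fin m)} (h : Disjoint A B) :
    val v i (A ∪ B) = val v i A + val v i B :=
  Finset.sum_union h

theorem val_sdiff (i : Fin n) {A B : Finset (Fin m)} (h : A ⊆ B) :
    val v i (B \ A) = val v i B - val v i A :=
  eq_sub_of_add_eq (Finset.sum_sdiff h)

theorem maxDrop_nonneg (hv : ∀ i g, 0 ≤ v i g) (i : Fin n) (B : Finset (Fin m)) :
    0 ≤ maxDrop v i B := by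
  unfold maxDrop
  split_ifs with h
  · obtain ⟨g, hg⟩ := h
    exact (val_nonneg hv i (B.erase g)).trans
      (Finset.le_sup' (fun g => val v i (B.erase g)) hg)
  · exact le_rfl

theorem maxDrop_le_val (hv : ∀ i g, 0 ≤ v i g) (i : Fin n) (B : Finset (Fin m)) :
    maxDrop v i B ≤ val v i B := by
  unfold maxDrop
  split_ifs with h
  · exact Finset.sup'_le _ _ fun g _ => val_mono hv i (Finset.erase_subset g B)
  · exact val_nonneg hv i B

theorem maxDrop_mono (hv : ∀ i g, 0 ≤ v i g) (i : Fin n) {A B : Finset (Fin m)} (h : A ⊆ B) :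
    maxDrop v i A ≤ maxDrop v i B := by
  by_cases hA : A.Nonempty
  · rw [maxDrop, maxDrop, dif_pos hA, dif_pos (hA.mono h)]
    exact Finset.sup'_le _ _ fun g hg => (val_mono hv i (Finset.erase_subset_erase g h)).trans
      (Finset.le_sup' (fun g => val v i (B.erase g)) (h hg))
  · rw [maxDrop, dif_neg hA]
    exact maxDrop_nonneg hv i B

theorem val_erase_eq_maxDrop {i : Fin n} {B : Finset (Fin m)} {c : Fin m}
    (hc : IsLeastItem v i B c) : val v i (B.erase c) = maxDrop v i B := by
  have key : ∀ g ∈ B, val v i (B.erase g) = val v i B - v i g := fun g hg =>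
    eq_sub_of_add_eq (Finset.sum_erase_add B (v i) hg)
  rw [maxDrop, dif_pos ⟨c, hc.1⟩]
  apply le_antisymm
  · exact Finset.le_sup' (fun g => val v i (B.erase g)) hc.1
  · refine Finset.sup'_le _ _ fun g hg => ?_
    rw [key g hg, key c hc.1]
    linarith [hc.2 g hg]

theorem removeItem_subset (Z : Bundles n m) (s : Fin n) (c : Fin m) (k : Fin n) :
    removeItem Z s c k ⊆ Z k := by
  unfold removeItem
  by_cases h : k = s
  · subst h
    simpa using Finset.erase_subset c (Z k)
  · simp [h]

theorem removeItem_of_ne (Z : Bundles n m) {s k : Fin n} (c : Fin m) (h : k ≠ s) :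
    removeItem Z s c k = Z k := by
  simp [removeItem, h]

theorem removeItem_self (Z : Bundles n m) (s : Fin n) (c : Fin m) :
    removeItem Z s c s = (Z s).erase c := by
  simp [removeItem]

/-! ### Handing a bundle to an unmatched agent -/

/-- The edge set obtained from `M` when the bundle `b` is taken from the agent who is matched to it
(if there is one) and matched to the agent `a`. -/
def rematch (M : Finset (Fin n × Fin n)) (a b : Fin n) : Finset (Fin n × Fin n) :=
  insert (a, b) (M.filter fun e => e.2 ≠ b)

theorem mem_rematch {M : Finset (Fin n × Fin n)} {a b : Fin n} {e : Fin n × Fin n} :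
    e ∈ rematch M a b ↔ e = (a, b) ∨ e ∈ M ∧ e.2 ≠ b := by
  simp [rematch]

theorem rematch_isMatching {Z Z' : Bundles n m} {M : Finset (Fin n × Fin n)} {a b : Fin n}
    (hM : IsMatching v Z M) (ha : ∀ y, (a, y) ∉ M) (hab : IsEdge v Z' a b)
    (h : ∀ e ∈ M, e.2 ≠ b → IsEdge v Z' e.1 e.2) : IsMatching v Z' (rematch M a b) := by
  have key : ∀ e ∈ M, e.1 ≠ a := fun e he h' => ha e.2 (h' ▸ he)
  refine ⟨fun e he => ?_, fun e he f hf hef => ?_⟩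
  · rcases mem_rematch.1 he with rfl | ⟨he, hb⟩
    exacts [hab, h e he hb]
  · rcases mem_rematch.1 he with rfl | ⟨he, hb⟩ <;> rcases mem_rematch.1 hf with rfl | ⟨hf, hb'⟩
    · rfl
    · rcases hef with h | h
      exacts [absurd h.symm (key f hf), absurd h.symm hb']
    · rcases hef with h | h
      exacts [absurd h (key e he), absurd h hb]
    · exact hM.2 e he f hf hef

theorem rematch_covers {M : Finset (Fin n × Fin n)} (a b : Fin n) {j : Fin n}
    (h : j = b ∨ ∃ i, (i, j) ∈ M) : ∃ i, (i, j) ∈ rematch M a b := by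
  by_cases hj : j = b
  · exact ⟨a, mem_rematch.2 (Or.inl (by rw [hj]))⟩
  · obtain ⟨i, hi⟩ := h.resolve_left hj
    exact ⟨i, mem_rematch.2 (Or.inr ⟨hi, hj⟩)⟩

theorem rematch_eq_insert_erase {Z : Bundles n m} {M : Finset (Fin n × Fin n)} {x b : Fin n}
    (hM : IsMatching v Z M) (hx : (x, b) ∈ M) (a : Fin n) :
    rematch M a b = insert (a, b) (M.erase (x, b)) := by
  unfold rematch
  congr 1
  ext e
  rw [Finset.mem_filter, Finset.mem_erase]
  constructor
  · rintro ⟨he, hb⟩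
    exact ⟨fun h => hb (by rw [h]), he⟩
  · rintro ⟨hne, he⟩
    exact ⟨he, fun h => hne (hM.2 e he _ hx (Or.inr h))⟩

theorem card_rematch_of_mem {Z : Bundles n m} {M : Finset (Fin n × Fin n)} {a x b : Fin n}
    (hM : IsMatching v Z M) (ha : ∀ y, (a, y) ∉ M) (hx : (x, b) ∈ M) :
    (rematch M a b).card = M.card := by
  rw [rematch_eq_insert_erase hM hx,
    Finset.card_insert_of_notMem fun h => ha b (Finset.mem_of_mem_erase h),
    Finset.card_erase_add_one hx]

theorem card_rematch_of_unmatched {M : Finset (Fin n × Fin n)} {a b : Fin n}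
    (hb : ∀ x, (x, b) ∉ M) : (rematch M a b).card = M.card + 1 := by
  have : M.filter (fun e => e.2 ≠ b) = M :=
    Finset.filter_true_of_mem fun e he h => hb e.1 (h ▸ he)
  rw [rematch, this, Finset.card_insert_of_notMem (hb a)]

theorem idCount_filter {M : Finset (Fin n × Fin n)} {b : Fin n} (hbb : (b, b) ∉ M) :
    (M.filter fun e => e.2 ≠ b).filter (fun e => e.1 = e.2) = M.filter fun e => e.1 = e.2 := by
  ext ⟨x, y⟩
  simp only [Finset.mem_filter]
  constructor
  · rintro ⟨⟨h, -⟩, h'⟩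
    exact ⟨h, h'⟩
  · rintro ⟨h, rfl⟩
    exact ⟨⟨h, fun h' => hbb (h' ▸ h)⟩, rfl⟩

theorem idCount_rematch_of_ne {M : Finset (Fin n × Fin n)} {a b : Fin n} (hab : a ≠ b)
    (hbb : (b, b) ∉ M) : idCount (rematch M a b) = idCount M := by
  rw [idCount, rematch, Finset.filter_insert, if_neg hab, idCount_filter hbb, idCount]

theorem idCount_rematch_self {M : Finset (Fin n × Fin n)} {a : Fin n} (ha : (a, a) ∉ M) :
    idCount (rematch M a a) = idCount M + 1 := by
  rw [idCount, rematch, Finset.filter_insert, if_pos rfl, idCount_filter ha,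
    Finset.card_insert_of_notMem fun h => ha (Finset.mem_filter.1 h).1, idCount]

/-! ### Chosen matchings -/

theorem exists_isChosenMatching {X Z : Bundles n m} (h : ∃ M, CoversTouched v X Z M) :
    ∃ M, IsChosenMatching v X Z M := by
  obtain ⟨M₁, h₁, h₁'⟩ := Set.exists_max_image {M | CoversTouched v X Z M} idCount
    (Set.toFinite _) h
  obtain ⟨M₂, h₂, h₂'⟩ := Set.exists_max_image {M | MaxIdentity v X Z M} Finset.card
    (Set.toFinite _) ⟨M₁, h₁, h₁'⟩
  exact ⟨M₂, h₂, h₂'⟩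

/-- An agent whom the matching leaves out is not content with her own bundle: otherwise she could
be given that bundle, whoever has it, which makes one more edge of the form `(i, Z i)`. -/
theorem MaxIdentity.not_isEdge_self {X Z : Bundles n m} {M : Finset (Fin n × Fin n)} {a : Fin n}
    (hM : MaxIdentity v X Z M) (ha : ∀ y, (a, y) ∉ M) : ¬ IsEdge v Z a a := by
  intro h
  have := hM.2 (rematch M a a)
    ⟨rematch_isMatching hM.1.1 ha h fun e he _ => hM.1.1.1 e he,
      fun j hj => rematch_covers a a (Or.inr (hM.1.2 j hj))⟩
  rw [idCount_rematch_self (ha a)] at this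
  omega

theorem MaxIdentity.val_lt_maxDrop {X Z : Bundles n m} {M : Finset (Fin n × Fin n)} {a b : Fin n}
    (hM : MaxIdentity v X Z M) (ha : ∀ y, (a, y) ∉ M) (hb : IsRobustDemand v Z a b) :
    val v a (Z a) < maxDrop v a (Z b) := by
  by_contra! h
  exact hM.not_isEdge_self ha ⟨fun k => (hb k).trans h, fun h' => absurd rfl h'⟩

theorem MaxIdentity.ne_of_isRobustDemand (hv : ∀ i g, 0 ≤ v i g) {X Z : Bundles n m}
    {M : Finset (Fin n × Fin n)} {a b : Fin n} (hM : MaxIdentity v X Z M)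
    (ha : ∀ y, (a, y) ∉ M) (hb : IsRobustDemand v Z a b) : a ≠ b := by
  rintro rfl
  exact absurd (hM.val_lt_maxDrop ha hb) (maxDrop_le_val hv a (Z a)).not_gt

theorem MaxIdentity.isEdge_of_isRobustDemand (hv : ∀ i g, 0 ≤ v i g) {X Z : Bundles n m}
    {M : Finset (Fin n × Fin n)} {a b : Fin n} (hM : MaxIdentity v X Z M)
    (ha : ∀ y, (a, y) ∉ M) (hb : IsRobustDemand v Z a b) : IsEdge v Z a b :=
  ⟨fun k => (hb k).trans (maxDrop_le_val hv a (Z b)),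
    fun _ => (hM.val_lt_maxDrop ha hb).trans_le (maxDrop_le_val hv a (Z b))⟩

theorem MaxIdentity.rematch (hv : ∀ i g, 0 ≤ v i g) {X Z : Bundles n m}
    {M : Finset (Fin n × Fin n)} {a b : Fin n} (hM : MaxIdentity v X Z M)
    (ha : ∀ y, (a, y) ∉ M) (hb : IsRobustDemand v Z a b) (hbb : (b, b) ∉ M) :
    MaxIdentity v X Z (rematch M a b) := by
  refine ⟨⟨rematch_isMatching hM.1.1 ha (hM.isEdge_of_isRobustDemand hv ha hb)
    fun e he _ => hM.1.1.1 e he, fun j hj => rematch_covers a b (Or.inr (hM.1.2 j hj))⟩, ?_⟩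
  rw [idCount_rematch_of_ne (hM.ne_of_isRobustDemand hv ha hb) hbb]
  exact hM.2

/-- A robust demand of an unmatched agent is matched, since otherwise the two could be matched to
each other, against the maximality of the size. -/
theorem IsChosenMatching.exists_mem_of_isRobustDemand (hv : ∀ i g, 0 ≤ v i g) {X Z : Bundles n m}
    {M : Finset (Fin n × Fin n)} {a b : Fin n} (hM : IsChosenMatching v X Z M)
    (ha : ∀ y, (a, y) ∉ M) (hb : IsRobustDemand v Z a b) : ∃ x, (x, b) ∈ M := by
  by_contra! h
  have := hM.2 _ (hM.1.rematch hv ha hb (h b))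
  rw [card_rematch_of_unmatched h] at this
  omega

/-- Taking a robust demand of an unmatched agent from an agent other than its owner changes neither
the size nor the number of edges `(i, Z i)`. -/
theorem IsChosenMatching.rematch (hv : ∀ i g, 0 ≤ v i g) {X Z : Bundles n m}
    {M : Finset (Fin n × Fin n)} {a x b : Fin n} (hM : IsChosenMatching v X Z M)
    (ha : ∀ y, (a, y) ∉ M) (hb : IsRobustDemand v Z a b) (hx : (x, b) ∈ M) (hxb : x ≠ b) :
    IsChosenMatching v X Z (rematch M a b) := by
  refine ⟨hM.1.rematch hv ha hb fun h => hxb ?_, ?_⟩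
  · exact congrArg Prod.fst (hM.1.1.1.2 _ hx _ h (Or.inr rfl))
  · rw [card_rematch_of_mem hM.1.1.1 ha hx]
    exact hM.2

/-- After an unmatched agent `a` has removed her least item from her robust demand `b`, giving her
the rest of `b` yields a matching that covers all touched bundles, also the new one. -/
theorem MaxIdentity.coversTouched_removeItem (hv : ∀ i g, 0 ≤ v i g) {X Z : Bundles n m}
    {M : Finset (Fin n × Fin n)} {a b : Fin n} {c : Fin m} (hM : MaxIdentity v X Z M)
    (ha : ∀ y, (a, y) ∉ M) (hb : IsRobustDemand v Z a b) (hc : IsLeastItem v a (Z b) c) :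
    CoversTouched v X (removeItem Z b c) (FairDivision.rematch M a b) := by
  have hab := hM.ne_of_isRobustDemand hv ha hb
  refine ⟨rematch_isMatching hM.1.1 ha ⟨fun k => ?_, fun _ => ?_⟩ fun e he heb =>
    ⟨fun k => ?_, fun hne => ?_⟩, fun j hj => rematch_covers a b ?_⟩
  · rw [removeItem_self, val_erase_eq_maxDrop hc]
    exact (maxDrop_mono hv a (removeItem_subset Z b c k)).trans (hb k)
  · rw [removeItem_self, val_erase_eq_maxDrop hc, removeItem_of_ne Z c hab]
    exact hM.val_lt_maxDrop ha hb
  · rw [removeItem_of_ne Z c heb]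
    exact (maxDrop_mono hv e.1 (removeItem_subset Z b c k)).trans ((hM.1.1.1 e he).1 k)
  · rw [removeItem_of_ne Z c heb]
    exact (val_mono hv e.1 (removeItem_subset Z b c e.1)).trans_lt ((hM.1.1.1 e he).2 hne)
  · by_cases h : j = b
    · exact Or.inl h
    · rw [removeItem_of_ne Z c h] at hj
      exact Or.inr (hM.1.2 j hj)

theorem exists_isRobustDemand (hn : 0 < n) (v : Fin n → Fin m → ℝ) (Z : Bundles n m) (a : Fin n) :
    ∃ b, IsRobustDemand v Z a b := by
  have : Nonempty (Fin n) := ⟨⟨0, hn⟩⟩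
  exact Finite.exists_max fun b => maxDrop v a (Z b)

theorem exists_isLeastItem {i : Fin n} {B : Finset (Fin m)} (h : B.Nonempty) :
    ∃ c, IsLeastItem v i B c := by
  obtain ⟨c, hc, h'⟩ := Finset.exists_min_image B (v i) h
  exact ⟨c, hc, h'⟩

theorem MaxIdentity.robustDemand_nonempty (hv : ∀ i g, 0 ≤ v i g) {X Z : Bundles n m}
    {M : Finset (Fin n × Fin n)} {a b : Fin n} (hM : MaxIdentity v X Z M)
    (ha : ∀ y, (a, y) ∉ M) (hb : IsRobustDemand v Z a b) : (Z b).Nonempty := by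
  by_contra h
  have := hM.val_lt_maxDrop ha hb
  rw [maxDrop, dif_neg h] at this
  exact this.not_ge (val_nonneg hv a (Z a))

/-! ### Augmenting paths -/

theorem IsAugmentingPath.congr {M : Finset (Fin n × Fin n)} {k : ℕ} {j j' : ℕ → Fin n}
    (hP : IsAugmentingPath M k j) (h : ∀ i, 1 ≤ i → i ≤ k → j' i = j i) :
    IsAugmentingPath M k j' where
  one_le := hP.one_le
  start_unmatched := by
    rw [h 1 le_rfl hP.one_le]
    exact hP.start_unmatched
  edges i hi hik := by
    rw [h i hi hik.le, h (i + 1) (by omega) hik]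
    exact hP.edges i hi hik
  simple := hP.simple.congr fun i hi => (h i hi.1 hi.2).symm
  end_unmatched := by
    rw [h k hP.one_le le_rfl]
    exact hP.end_unmatched

/-- Follow `M` from the unmatched bundle `j₁`; the agents met are distinct because `M` is a
matching, so that one of them is unmatched. -/
theorem exists_isAugmentingPath {Z : Bundles n m} {M : Finset (Fin n × Fin n)} {j₁ : Fin n}
    (hM : IsMatching v Z M) (hj₁ : ∀ i, (i, j₁) ∉ M) :
    ∃ k j, IsAugmentingPath M k j ∧ j 1 = j₁ := by
  by_contra! hno
  have key : ∀ k : ℕ, ∃ j : ℕ → Fin n, j 1 = j₁ ∧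
      (∀ i, 1 ≤ i → i < k + 1 → (j i, j (i + 1)) ∈ M) ∧ Set.InjOn j (Set.Icc 1 (k + 1)) := by
    intro k
    induction k with
    | zero =>
      refine ⟨fun _ => j₁, rfl, fun i h h' => by omega, fun x hx y hy _ => ?_⟩
      simp only [Set.mem_Icc] at hx hy
      omega
    | succ k ih =>
      obtain ⟨j, h1, he, hs⟩ := ih
      have : ∃ b, (j (k + 1), b) ∈ M := by
        by_contra! hend
        exact hno (k + 1) j ⟨by omega, h1 ▸ hj₁, he, hs, hend⟩ h1
      obtain ⟨b, hb⟩ := this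
      have hne : ∀ i, 1 ≤ i → i ≤ k + 1 → j i ≠ b := by
        rintro i hi hik rfl
        obtain rfl | ⟨l, rfl⟩ : i = 1 ∨ ∃ l, i = l + 1 + 1 := by
          rcases i with _ | _ | l
          · omega
          · exact Or.inl rfl
          · exact Or.inr ⟨l, rfl⟩
        · exact hj₁ _ (h1 ▸ hb)
        · have h := congrArg Prod.fst
            (hM.2 _ (he (l + 1) (by omega) (by omega)) _ hb (Or.inr rfl))
          have := hs (by constructor <;> omega) (by constructor <;> omega) h
          omega
      refine ⟨Function.update j (k + 2) b, ?_, fun i hi hik => ?_, fun x hx y hy hxy => ?_⟩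
      · rwa [Function.update_of_ne (by omega)]
      · rw [Function.update_of_ne (by omega)]
        by_cases h : i = k + 1
        · subst h
          rwa [Function.update_self]
        · rw [Function.update_of_ne (by omega)]
          exact he i hi (by omega)
      · simp only [Set.mem_Icc] at hx hy
        by_cases hx' : x = k + 2 <;> by_cases hy' : y = k + 2
        · omega
        · rw [hx', Function.update_self, Function.update_of_ne hy'] at hxy
          exact absurd hxy.symm (hne y hy.1 (by omega))
        · rw [hy', Function.update_self, Function.update_of_ne hx'] at hxy
          exact absurd hxy (hne x hx.1 (by omega))
        · rw [Function.update_of_ne hx', Function.update_of_ne hy'] at hxy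
          exact hs ⟨hx.1, by omega⟩ ⟨hy.1, by omega⟩ hxy
  obtain ⟨j, -, -, hs⟩ := key n
  have := Finset.card_le_card_of_injOn (s := Finset.Icc 1 (n + 1)) (t := Finset.univ) j
    (fun _ _ => Finset.mem_coe.2 (Finset.mem_univ _)) (by rwa [Finset.coe_Icc])
  simp at this

open Classical in
/-- The agents reached from `j₁` when an agent `x` leads to the agent `y` whose bundle is matched
to `x`. -/
noncomputable def reach (M : Finset (Fin n × Fin n)) (j₁ : Fin n) : Finset (Fin n) :=
  Finset.univ.filter fun a => Relation.ReflTransGen (fun x y => (x, y) ∈ M) j₁ a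

theorem mem_reach {M : Finset (Fin n × Fin n)} {j₁ a : Fin n} :
    a ∈ reach M j₁ ↔ Relation.ReflTransGen (fun x y => (x, y) ∈ M) j₁ a := by
  simp [reach]

theorem IsAugmentingPath.mem_reach {M : Finset (Fin n × Fin n)} {k : ℕ} {j : ℕ → Fin n}
    (hP : IsAugmentingPath M k j) {i : ℕ} (hi : 1 ≤ i) (hik : i ≤ k) : j i ∈ reach M (j 1) := by
  rw [FairDivision.mem_reach]
  induction i, hi using Nat.le_induction with
  | base => exact Relation.ReflTransGen.refl
  | succ i hi ih => exact (ih (by omega)).tail (hP.edges i hi (by omega))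

/-- Rematching a bundle on the path cuts the path short. -/
theorem IsAugmentingPath.reach_rematch_ssubset {Z : Bundles n m} {M : Finset (Fin n × Fin n)}
    {k : ℕ} {j : ℕ → Fin n} {i : ℕ} (hM : IsMatching v Z M) (hP : IsAugmentingPath M k j)
    (hi : 1 ≤ i) (hik : i < k) :
    reach (rematch M (j k) (j (i + 1))) (j 1) ⊂ reach M (j 1) := by
  have key : ∀ a ∈ reach (rematch M (j k) (j (i + 1))) (j 1),
      ∃ l, 1 ≤ l ∧ l ≤ i ∧ a = j l := by
    intro a ha
    rw [FairDivision.mem_reach] at ha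
    induction ha with
    | refl => exact ⟨1, le_rfl, hi, rfl⟩
    | tail _ hbc ih =>
      obtain ⟨l, hl, hli, rfl⟩ := ih
      have hlM := hP.edges l hl (by omega)
      rcases mem_rematch.1 hbc with h | ⟨h, hne⟩
      · have := hP.simple ⟨hl, by omega⟩ ⟨hP.one_le, le_rfl⟩ (congrArg Prod.fst h)
        omega
      · have hc := congrArg Prod.snd (hM.2 _ h _ hlM (Or.inl rfl))
        simp only at hc hne
        refine ⟨l + 1, by omega, ?_, hc⟩
        by_contra h'
        exact hne (by rw [hc, show l = i by omega])
  refine (Finset.ssubset_iff_of_subset fun a ha => ?_).2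
    ⟨j k, hP.mem_reach hP.one_le le_rfl, fun h => ?_⟩
  · obtain ⟨l, hl, hli, rfl⟩ := key a ha
    exact hP.mem_reach hl (by omega)
  · obtain ⟨l, hl, hli, h⟩ := key _ h
    have := hP.simple ⟨hP.one_le, le_rfl⟩ ⟨hl, by omega⟩ h
    omega

/-! ### The improved allocation -/

theorem isAllocation_univ_iff {X : Bundles n m} :
    IsAllocation Finset.univ X ↔
      (∀ g, ∃ a, g ∈ X a) ∧ ∀ g a b, g ∈ X a → g ∈ X b → a = b := by
  constructor
  · rintro ⟨hd, hu⟩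
    refine ⟨fun g => ?_, fun g a b ha hb => ?_⟩
    · simpa [← hu] using Finset.mem_univ g
    · by_contra h
      exact Finset.disjoint_left.1 (hd a b h) ha hb
  · rintro ⟨he, hd⟩
    refine ⟨fun a b hab => Finset.disjoint_left.2 fun g ha hb => hab (hd g a b ha hb), ?_⟩
    ext g
    simpa using he g

/-- Who owns an item after the reallocation: the items of `X b` stay, except for those of `Z b` if
`b` is one of `j 2, …, j (k + 1)`, and `Z (j (i + 1))` goes to `j i`. -/
theorem IsReallocation.mem_iff {X Z Xh : Bundles n m} {k : ℕ} {j : ℕ → Fin n}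
    (hk : 1 ≤ k) (hj : Set.InjOn j (Set.Icc 1 (k + 1))) (h : IsReallocation X Z k j Xh)
    (g : Fin m) (b : Fin n) :
    g ∈ Xh b ↔ (g ∈ X b ∧ ∀ i, 1 ≤ i → i ≤ k → j (i + 1) = b → g ∉ Z b) ∨
      ∃ i, 1 ≤ i ∧ i ≤ k ∧ j i = b ∧ g ∈ Z (j (i + 1)) := by
  have inj : ∀ {x y}, 1 ≤ x → x ≤ k + 1 → 1 ≤ y → y ≤ k + 1 → j x = j y → x = y :=
    fun h1 h2 h3 h4 h5 => hj ⟨h1, h2⟩ ⟨h3, h4⟩ h5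
  by_cases hb : ∃ i, 1 ≤ i ∧ i ≤ k + 1 ∧ j i = b
  · obtain ⟨i, hi, hik, rfl⟩ := hb
    have hgive : (∃ i', 1 ≤ i' ∧ i' ≤ k ∧ j i' = j i ∧ g ∈ Z (j (i' + 1))) ↔
        i ≤ k ∧ g ∈ Z (j (i + 1)) := by
      constructor
      · rintro ⟨i', h1, h2, h3, h4⟩
        obtain rfl := inj h1 (by omega) hi hik h3
        exact ⟨h2, h4⟩
      · rintro ⟨h1, h2⟩
        exact ⟨i, hi, h1, rfl, h2⟩
    have hlose : (∀ i', 1 ≤ i' → i' ≤ k → j (i' + 1) = j i → g ∉ Z (j i)) ↔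
        (i = 1 ∨ g ∉ Z (j i)) := by
      constructor
      · intro h
        by_cases h1 : i = 1
        · exact Or.inl h1
        · exact Or.inr (h (i - 1) (by omega) (by omega) (by rw [Nat.sub_add_cancel hi]))
      · rintro h i' h1 h2 h3
        have := inj (by omega) (by omega) hi hik h3
        exact h.resolve_left (by omega)
    rw [hgive, hlose]
    rcases Nat.lt_or_ge i 2 with h1 | h1
    · obtain rfl : i = 1 := by omega
      simp [h.first, hk]
    · rcases Nat.lt_or_ge k i with h2 | h2
      · obtain rfl : i = k + 1 := by omega
        have : k ≠ 0 := by omega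
        simp [h.last, this]
      · have : i ≠ 1 := by omega
        simp [h.middle i h1 h2, h2, this]
  · push Not at hb
    rw [h.rest b hb]
    constructor
    · exact fun hg => Or.inl ⟨hg, fun i h1 h2 h3 => absurd h3 (hb (i + 1) (by omega) (by omega))⟩
    · rintro (⟨hg, -⟩ | ⟨i, h1, h2, h3, -⟩)
      · exact hg
      · exact absurd h3 (hb i h1 (by omega))

theorem IsReallocation.isAllocation {X Z Xh : Bundles n m} {k : ℕ} {j : ℕ → Fin n}
    (hk : 1 ≤ k) (hj : Set.InjOn j (Set.Icc 1 (k + 1))) (h : IsReallocation X Z k j Xh)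
    (hZ : ∀ b, Z b ⊆ X b) (hX : IsAllocation Finset.univ X) : IsAllocation Finset.univ Xh := by
  obtain ⟨hex, huniq⟩ := isAllocation_univ_iff.1 hX
  refine isAllocation_univ_iff.2 ⟨fun g => ?_, fun g a b ha hb => ?_⟩
  · obtain ⟨a, ha⟩ := hex g
    by_cases hmove : ∃ i, 1 ≤ i ∧ i ≤ k ∧ j (i + 1) = a ∧ g ∈ Z a
    · obtain ⟨i, h1, h2, rfl, h4⟩ := hmove
      exact ⟨j i, (h.mem_iff hk hj g _).2 (Or.inr ⟨i, h1, h2, rfl, h4⟩)⟩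
    · push Not at hmove
      exact ⟨a, (h.mem_iff hk hj g a).2 (Or.inl ⟨ha, hmove⟩)⟩
  · rw [h.mem_iff hk hj] at ha hb
    rcases ha with ⟨ha, ha'⟩ | ⟨i, h1, h2, rfl, h4⟩ <;>
      rcases hb with ⟨hb, hb'⟩ | ⟨l, l1, l2, rfl, l4⟩
    · exact huniq g a b ha hb
    · have := huniq g _ _ (hZ _ l4) ha
      exact absurd (this ▸ l4) (ha' l l1 l2 this)
    · have := huniq g _ _ (hZ _ h4) hb
      exact absurd (this ▸ h4) (hb' i h1 h2 this)
    · have := hj ⟨by omega, by omega⟩ ⟨by omega, by omega⟩ (huniq g _ _ (hZ _ h4) (hZ _ l4))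
      rw [show i = l by omega]

theorem exists_isReallocation (X Z : Bundles n m) {k : ℕ} {j : ℕ → Fin n}
    (hk : 1 ≤ k) (hj : Set.InjOn j (Set.Icc 1 (k + 1))) : ∃ Xh, IsReallocation X Z k j Xh := by
  classical
  have hF : ∀ a, ∃ B : Finset (Fin m), ∀ i, 1 ≤ i → i ≤ k + 1 → j i = a →
      B = if i = 1 then X a ∪ Z (j 2) else if i = k + 1 then X a \ Z a
        else X a \ Z a ∪ Z (j (i + 1)) := by
    intro a
    by_cases ha : ∃ i, 1 ≤ i ∧ i ≤ k + 1 ∧ j i = a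
    · obtain ⟨i, h1, h2, h3⟩ := ha
      refine ⟨if i = 1 then X a ∪ Z (j 2) else if i = k + 1 then X a \ Z a
        else X a \ Z a ∪ Z (j (i + 1)), fun l l1 l2 l3 => ?_⟩
      rw [hj ⟨l1, l2⟩ ⟨h1, h2⟩ (l3.trans h3.symm)]
    · exact ⟨∅, fun i h1 h2 h3 => absurd ⟨i, h1, h2, h3⟩ ha⟩
  choose F hF using hF
  refine ⟨fun a => if ∃ i, 1 ≤ i ∧ i ≤ k + 1 ∧ j i = a then F a else X a, ?_, ?_, ?_, ?_⟩
  · rw [if_pos ⟨1, le_rfl, by omega, rfl⟩, hF (j 1) 1 le_rfl (by omega) rfl, if_pos rfl]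
  · intro i h1 h2
    rw [if_pos ⟨i, by omega, by omega, rfl⟩, hF (j i) i (by omega) (by omega) rfl,
      if_neg (by omega), if_neg (by omega)]
  · rw [if_pos ⟨k + 1, by omega, le_rfl, rfl⟩, hF (j (k + 1)) (k + 1) (by omega) le_rfl rfl,
      if_neg (by omega), if_pos rfl]
  · intro a ha
    rw [if_neg]
    rintro ⟨i, h1, h2, h3⟩
    exact ha i h1 h2 h3

/-- The change of the agents' values from `f` to `h` in an improvement: one agent doubles her value
and gets a positive one, another one, with positive value, keeps the fraction `(1 + δ) / 2` of it,
and nobody else loses. -/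
def IsGain (δ : ℝ) (f h : Fin n → ℝ) : Prop :=
  ∃ p q, p ≠ q ∧ 2 * f p ≤ h p ∧ 0 < h p ∧ 0 < f q ∧ (1 + δ) / 2 * f q ≤ h q ∧
    ∀ a, a ≠ q → f a ≤ h a

/-- Every agent `j i` with `i ≤ k` prefers what she receives to what she gives away; the agent
`j 1` gives nothing away. -/
theorem IsReallocation.isGain (hv : ∀ i g, 0 ≤ v i g) {δ : ℝ} (hδ1 : δ < 1)
    {X Z Xh : Bundles n m} {k : ℕ} {j : ℕ → Fin n}
    (hk : 1 ≤ k) (hj : Set.InjOn j (Set.Icc 1 (k + 1))) (h : IsReallocation X Z k j Xh)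
    (hZ : ∀ b, Z b ⊆ X b) (hX : IsAllocation Finset.univ X) (h1 : Z (j 1) = X (j 1))
    (hpref : ∀ i, 1 ≤ i → i ≤ k → val v (j i) (Z (j i)) < val v (j i) (Z (j (i + 1))))
    (hlow : (2 + delta₁ δ) * val v (j (k + 1)) (Z (j (k + 1)))
      < val v (j (k + 1)) (X (j (k + 1)))) :
    IsGain δ (fun a => val v a (X a)) (fun a => val v a (Xh a)) := by
  have hne : ∀ i, 1 ≤ i → i ≤ k → j i ≠ j (i + 1) := fun i h1 h2 h3 => by
    have := hj ⟨h1, by omega⟩ ⟨by omega, by omega⟩ h3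
    omega
  have hfirst : val v (j 1) (Xh (j 1)) = val v (j 1) (X (j 1)) + val v (j 1) (Z (j 2)) := by
    rw [h.first]
    exact val_union _ ((hX.1 _ _ (hne 1 le_rfl hk)).mono_right (hZ _))
  have hmid : ∀ i, 2 ≤ i → i ≤ k → val v (j i) (Xh (j i)) =
      val v (j i) (X (j i)) - val v (j i) (Z (j i)) + val v (j i) (Z (j (i + 1))) := by
    intro i h2 h3
    rw [h.middle i h2 h3, val_union, val_sdiff _ (hZ _)]
    exact (hX.1 _ _ (hne i (by omega) h3)).mono Finset.sdiff_subset (hZ _)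
  have hlast : val v (j (k + 1)) (Xh (j (k + 1))) =
      val v (j (k + 1)) (X (j (k + 1))) - val v (j (k + 1)) (Z (j (k + 1))) := by
    rw [h.last, val_sdiff _ (hZ _)]
  have hp1 := hpref 1 le_rfl hk
  rw [h1] at hp1
  have hx1 := val_nonneg hv (j 1) (X (j 1))
  have hzl := val_nonneg hv (j (k + 1)) (Z (j (k + 1)))
  have hd : 2 + delta₁ δ = 2 / (1 - δ) := by
    have : 1 - δ ≠ 0 := by linarith
    unfold delta₁
    field_simp
    ring
  rw [hd, div_mul_eq_mul_div, div_lt_iff₀ (by linarith)] at hlow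
  refine ⟨j 1, j (k + 1), fun h => ?_, ?_, ?_, ?_, ?_, fun a ha => ?_⟩
  · have := hj ⟨le_rfl, by omega⟩ ⟨by omega, le_rfl⟩ h
    omega
  · simp only [hfirst]
    linarith
  · simp only [hfirst]
    linarith
  · exact pos_of_mul_pos_left (by linarith) (by linarith : 0 ≤ 1 - δ)
  · simp only [hlast]
    linarith
  · simp only
    by_cases hon : ∃ i, 1 ≤ i ∧ i ≤ k ∧ j i = a
    · obtain ⟨i, h2, h3, rfl⟩ := hon
      rcases Nat.lt_or_ge i 2 with h4 | h4
      · obtain rfl : i = 1 := by omega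
        linarith
      · rw [hmid i h4 h3]
        linarith [hpref i h2 h3]
    · push Not at hon
      rw [h.rest a fun i h2 h3 h4 => ?_]
      by_cases h5 : i = k + 1
      · exact ha (h5 ▸ h4.symm)
      · exact hon i h2 (by omega) h4

theorem one_add_mul_prod_le_of_double {δ : ℝ} (hδ0 : 0 ≤ δ) {f h : Fin n → ℝ} (hf : ∀ a, 0 ≤ f a) {p q : Fin n}
    (hpq : p ≠ q) (hp : 2 * f p ≤ h p) (hq : (1 + δ) / 2 * f q ≤ h q)
    (hr : ∀ a, a ≠ q → f a ≤ h a) {s : Finset (Fin n)} (hps : p ∈ s) (hqs : q ∈ s) :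
    (1 + δ) * ∏ a ∈ s, f a ≤ ∏ a ∈ s, h a := by
  have hc : ∏ a ∈ s, ((if a = p then 2 else 1) * if a = q then (1 + δ) / 2 else 1) = 1 + δ := by
    rw [Finset.prod_mul_distrib, Finset.prod_ite_eq', Finset.prod_ite_eq', if_pos hps, if_pos hqs]
    ring
  rw [← hc, ← Finset.prod_mul_distrib]
  refine Finset.prod_le_prod (fun a _ => ?_) fun a _ => ?_
  · refine mul_nonneg (mul_nonneg ?_ ?_) (hf a) <;> split_ifs <;> linarith
  · by_cases h1 : a = p
    · subst h1
      simpa [hpq] using hp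
    · by_cases h2 : a = q
      · subst h2
        simpa [h1] using hq
      · simpa [h1, h2] using hr a h2

theorem IsGain.one_add_mul_prod_le {δ : ℝ} (hδ0 : 0 ≤ δ) {f h : Fin n → ℝ} (hf : ∀ a, 0 ≤ f a)
    (hg : IsGain δ f h) : (1 + δ) * ∏ a, f a ≤ ∏ a, h a := by
  obtain ⟨p, q, hpq, hp, -, -, hq, hr⟩ := hg
  exact one_add_mul_prod_le_of_double hδ0 hf hpq hp hq hr (Finset.mem_univ p) (Finset.mem_univ q)

/-- A quantity that grows in every improvement, even while the Nash welfare is `0`: the number of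
agents with positive value and then the product of these values. -/
noncomputable def potential (f : Fin n → ℝ) : ℕ ×ₗ ℝ :=
  toLex ((Finset.univ.filter fun a => 0 < f a).card, ∏ a with 0 < f a, f a)

theorem IsGain.potential_lt {δ : ℝ} (hδ0 : 0 < δ) {f h : Fin n → ℝ} (hf : ∀ a, 0 ≤ f a)
    (hg : IsGain δ f h) : potential f < potential h := by
  obtain ⟨p, q, hpq, hp, hp0, hq0, hq, hr⟩ := hg
  have hsub : (Finset.univ.filter fun a => 0 < f a) ⊆ Finset.univ.filter fun a => 0 < h a := by
    intro a ha
    rw [Finset.mem_filter] at ha ⊢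
    refine ⟨ha.1, ?_⟩
    by_cases haq : a = q
    · subst haq
      exact (mul_pos (by linarith) ha.2).trans_le hq
    · exact ha.2.trans_le (hr a haq)
  rw [potential, potential, Prod.Lex.toLex_lt_toLex]
  rcases hsub.eq_or_ssubset with heq | hss
  · refine Or.inr ⟨by rw [heq], ?_⟩
    have hps : p ∈ Finset.univ.filter fun a => 0 < f a := by
      rw [heq]
      exact Finset.mem_filter.2 ⟨Finset.mem_univ p, hp0⟩
    have hqs : q ∈ Finset.univ.filter fun a => 0 < f a :=
      Finset.mem_filter.2 ⟨Finset.mem_univ q, hq0⟩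
    have hpos : 0 < ∏ a with 0 < f a, f a :=
      Finset.prod_pos fun a ha => (Finset.mem_filter.1 ha).2
    have hle := one_add_mul_prod_le_of_double hδ0.le hf hpq hp hq hr hps hqs
    simp only
    rw [← heq]
    nlinarith
  · exact Or.inl (Finset.card_lt_card hss)

/-! ### Nash welfare -/

theorem prod_val_nonneg (hv : ∀ i g, 0 ≤ v i g) (X : Bundles n m) : 0 ≤ ∏ i, val v i (X i) :=
  Finset.prod_nonneg fun i _ => val_nonneg hv i (X i)

theorem NW_nonneg (hv : ∀ i g, 0 ≤ v i g) (X : Bundles n m) : 0 ≤ NW v X :=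
  Real.rpow_nonneg (prod_val_nonneg hv X) _

theorem NW_pow (hn : 0 < n) (hv : ∀ i g, 0 ≤ v i g) (X : Bundles n m) :
    NW v X ^ n = ∏ i, val v i (X i) := by
  rw [NW, one_div, Real.rpow_inv_natCast_pow (prod_val_nonneg hv X) hn.ne']

theorem mul_NW_le (hn : 0 < n) (hv : ∀ i g, 0 ≤ v i g) {c : ℝ} (hc : 0 ≤ c) {X Y : Bundles n m}
    (h : c * ∏ i, val v i (X i) ≤ ∏ i, val v i (Y i)) :
    c ^ ((1 : ℝ) / n) * NW v X ≤ NW v Y := by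
  rw [NW, NW, ← Real.mul_rpow hc (prod_val_nonneg hv X)]
  exact Real.rpow_le_rpow (mul_nonneg hc (prod_val_nonneg hv X)) h (by positivity)

theorem NW_le_opt {X : Bundles n m} {S : Finset (Fin m)} (hX : IsAllocation S X) :
    NW v X ≤ opt v S := by
  refine le_csSup (Set.Finite.bddAbove ?_) ⟨X, hX, rfl⟩
  refine (Set.finite_range (NW v)).subset ?_
  rintro w ⟨X, -, rfl⟩
  exact ⟨X, rfl⟩

/-- The items outside `S` can be given to any agent, which does not decrease the Nash welfare. -/
theorem NW_le_opt_univ (hn : 0 < n) (hv : ∀ i g, 0 ≤ v i g) {Y : Bundles n m} {S : Finset (Fin m)}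
    (hY : IsAllocation S Y) : NW v Y ≤ opt v (Finset.univ : Finset (Fin m)) := by
  set Y' : Bundles n m := Function.update Y ⟨0, hn⟩ (Y ⟨0, hn⟩ ∪ Sᶜ) with hY'
  have hmem : ∀ g a, g ∈ Y' a ↔ g ∈ Y a ∨ g ∉ S ∧ a = ⟨0, hn⟩ := by
    intro g a
    by_cases ha : a = ⟨0, hn⟩
    · subst ha
      simp [hY']
    · simp [hY', ha]
  have hS : ∀ g a, g ∈ Y a → g ∈ S := fun g a h => by
    rw [← hY.2]
    exact Finset.mem_biUnion.2 ⟨a, Finset.mem_univ a, h⟩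
  have hall : IsAllocation Finset.univ Y' := by
    refine isAllocation_univ_iff.2 ⟨fun g => ?_, fun g a b ha hb => ?_⟩
    · by_cases hg : g ∈ S
      · rw [← hY.2] at hg
        obtain ⟨a, -, ha⟩ := Finset.mem_biUnion.1 hg
        exact ⟨a, (hmem g a).2 (Or.inl ha)⟩
      · exact ⟨_, (hmem g _).2 (Or.inr ⟨hg, rfl⟩)⟩
    · rcases (hmem g a).1 ha with ha | ⟨ha, ha'⟩ <;> rcases (hmem g b).1 hb with hb | ⟨hb, hb'⟩
      · by_contra h
        exact Finset.disjoint_left.1 (hY.1 a b h) ha hb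
      · exact absurd (hS g a ha) hb
      · exact absurd (hS g b hb) ha
      · rw [ha', hb']
  refine le_trans ?_ (NW_le_opt hall)
  refine Real.rpow_le_rpow (prod_val_nonneg hv Y) ?_ (by positivity)
  exact Finset.prod_le_prod (fun i _ => val_nonneg hv i _) fun i _ =>
    val_mono hv i fun g hg => (hmem g i).2 (Or.inl hg)

/-- For negative `ρ`, efficiency means that all Nash welfares are `0`. -/
theorem IsEfficient.nonneg_or (hv : ∀ i g, 0 ≤ v i g) {ρ : ℝ} {X : Bundles n m}
    (h : IsEfficient v ρ X) :
    0 ≤ ρ ∨ opt v (Finset.univ : Finset (Fin m)) ≤ 0 := by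
  by_contra! h'
  exact absurd (h.trans (mul_nonpos_of_nonpos_of_nonneg h'.1.le (NW_nonneg hv X))) h'.2.not_ge

/-! ### Invariants of an execution -/

/-- The invariant at the head of a round with input allocation `X` and current bundles `Z`. -/
structure RoundInv (v : Fin n → Fin m → ℝ) (δ : ℝ) (X Z : Bundles n m) : Prop where
  subset : ∀ j, Z j ⊆ X j
  untouched : ∃ j, Z j = X j
  covers : ∃ M, CoversTouched v X Z M
  value : ∀ j, val v j (X j) ≤ (2 + delta₁ δ) * val v j (Z j)

/-- The invariant of an execution with input allocation `X`; for final states, what the execution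
guarantees about its result. -/
def StateInv (v : Fin n → Fin m → ℝ) (δ : ℝ) (X : Bundles n m) : State n m → Prop
  | State.outer Z => RoundInv v δ X Z
  | State.inner Z M j₁ => RoundInv v δ X Z ∧ IsChosenMatching v X Z M ∧ ∀ i, (i, j₁) ∉ M
  | State.returnedEFX Y => (∃ S, IsAllocation S Y) ∧ IsEFX v Y ∧
      ∏ i, val v i (X i) ≤ 2 ^ n * ∏ i, val v i (Y i)
  | State.returnedImproved Xh => IsAllocation Finset.univ Xh ∧
      IsGain δ (fun a => val v a (X a)) (fun a => val v a (Xh a))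

theorem roundInv_self (hn : 0 < n) (hv : ∀ i g, 0 ≤ v i g) {δ : ℝ} (hδ : 0 ≤ delta₁ δ)
    (X : Bundles n m) : RoundInv v δ X X where
  subset _ := subset_rfl
  untouched := ⟨⟨0, hn⟩, rfl⟩
  covers := ⟨∅, ⟨by simp, by simp⟩, fun j h => absurd rfl h⟩
  value j := by nlinarith [val_nonneg hv j (X j)]

/-- One untouched bundle makes up for the surplus of `2 + 1 / n` over `2` on the others. -/
theorem two_add_inv_pow_le (hn : 0 < n) : (2 + 1 / (n : ℝ)) ^ (n - 1) ≤ 2 ^ n := by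
  obtain ⟨k, rfl⟩ : ∃ k, n = k + 1 := ⟨n - 1, by omega⟩
  have hk : (0 : ℝ) < ((k + 1 : ℕ) : ℝ) := by positivity
  set x : ℝ := 1 / (2 * ((k + 1 : ℕ) : ℝ)) with hx
  have h2 : (2 : ℝ) + 1 / ((k + 1 : ℕ) : ℝ) = 2 * (x + 1) := by
    rw [hx]
    field_simp
    ring
  have hexp : (x + 1) ^ k ≤ 2 := by
    have h1 : (x + 1) ^ k ≤ Real.exp (k * x) := by
      rw [Real.exp_nat_mul]
      exact pow_le_pow_left₀ (by positivity) (Real.add_one_le_exp x) k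
    have h3 : (k : ℝ) * x ≤ Real.log 2 := by
      have : (k : ℝ) * x ≤ 1 / 2 := by
        rw [hx, mul_one_div, div_le_div_iff₀ (by positivity) two_pos]
        push_cast
        linarith
      linarith [Real.log_two_gt_d9]
    exact h1.trans ((Real.le_log_iff_exp_le two_pos).1 h3)
  rw [Nat.add_sub_cancel, h2, mul_pow, pow_succ]
  exact mul_le_mul_of_nonneg_left hexp (by positivity)

theorem RoundInv.prod_le (hv : ∀ i g, 0 ≤ v i g) {δ : ℝ} (hn : 0 < n)
    (hδ : delta₁ δ = 1 / n) {X Z : Bundles n m} (h : RoundInv v δ X Z) :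
    ∏ i, val v i (X i) ≤ 2 ^ n * ∏ i, val v i (Z i) := by
  obtain ⟨j, hj⟩ := h.untouched
  have hv' := h.value
  rw [hδ] at hv'
  rw [← Finset.mul_prod_erase Finset.univ (fun i => val v i (X i)) (Finset.mem_univ j),
    ← Finset.mul_prod_erase Finset.univ (fun i => val v i (Z i)) (Finset.mem_univ j), hj,
    mul_left_comm]
  refine mul_le_mul_of_nonneg_left ?_ (val_nonneg hv j _)
  calc ∏ i ∈ Finset.univ.erase j, val v i (X i)
      ≤ ∏ i ∈ Finset.univ.erase j, ((2 + 1 / (n : ℝ)) * val v i (Z i)) :=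
        Finset.prod_le_prod (fun i _ => val_nonneg hv i _) fun i _ => hv' i
    _ = (2 + 1 / (n : ℝ)) ^ (n - 1) * ∏ i ∈ Finset.univ.erase j, val v i (Z i) := by
        rw [Finset.prod_mul_distrib, Finset.prod_const,
          Finset.card_erase_of_mem (Finset.mem_univ j), Finset.card_univ, Fintype.card_fin]
    _ ≤ _ := mul_le_mul_of_nonneg_right (two_add_inv_pow_le hn)
        (Finset.prod_nonneg fun i _ => val_nonneg hv i _)

theorem IsMatching.exists_perm {Z : Bundles n m} {M : Finset (Fin n × Fin n)}
    (hM : IsMatching v Z M) (hcard : M.card = n) :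
    ∃ σ : Equiv.Perm (Fin n), ∀ i, (i, σ i) ∈ M := by
  have h1 : M.image Prod.fst = Finset.univ := by
    rw [← Finset.card_eq_iff_eq_univ, Finset.card_image_of_injOn, hcard, Fintype.card_fin]
    exact fun e he f hf h => hM.2 e he f hf (Or.inl h)
  have h2 : ∀ i, ∃ b, (i, b) ∈ M := fun i => by
    have := Finset.mem_univ i
    rw [← h1] at this
    obtain ⟨e, he, rfl⟩ := Finset.mem_image.1 this
    exact ⟨e.2, he⟩
  choose f hf using h2
  have hinj : Function.Injective f := fun i i' h =>
    congrArg Prod.fst (hM.2 _ (hf i) _ (hf i') (Or.inr h))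
  exact ⟨Equiv.ofBijective f (Finite.injective_iff_bijective.1 hinj), hf⟩

theorem stateInv_finish (hn : 0 < n) (hv : ∀ i g, 0 ≤ v i g) {δ : ℝ} (hδ : delta₁ δ = 1 / n)
    {X Z Y : Bundles n m} {M : Finset (Fin n × Fin n)} (hX : IsAllocation Finset.univ X)
    (hZ : RoundInv v δ X Z) (hM : IsMatching v Z M) (hcard : M.card = n)
    (hY : ∀ e ∈ M, Y e.1 = Z e.2) : StateInv v δ X (State.returnedEFX Y) := by
  obtain ⟨σ, hσ⟩ := hM.exists_perm hcard
  have hYσ : ∀ i, Y i = Z (σ i) := fun i => hY _ (hσ i)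
  refine ⟨⟨_, fun i j hij => ?_, rfl⟩, fun i j => ?_, ?_⟩
  · rw [hYσ, hYσ]
    exact (hX.1 _ _ (σ.injective.ne hij)).mono (hZ.subset _) (hZ.subset _)
  · rw [hYσ, hYσ]
    exact (hM.1 _ (hσ i)).1 _
  · refine (hZ.prod_le hv hn hδ).trans (mul_le_mul_of_nonneg_left ?_ (by positivity))
    refine Finset.prod_le_prod (fun i _ => val_nonneg hv i _) fun i _ => ?_
    rw [hYσ]
    by_cases h : i = σ i
    · rw [← h]
    · exact ((hM.1 _ (hσ i)).2 h).le

/-- The robust demand of the last agent of the path, if it is not on the path, is also not the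
first bundle, which is unmatched. -/
theorem injOn_succ (hv : ∀ i g, 0 ≤ v i g) {X Z : Bundles n m} {M : Finset (Fin n × Fin n)}
    {k : ℕ} {j : ℕ → Fin n} (hM : IsChosenMatching v X Z M) (hP : IsAugmentingPath M k j)
    (hR : IsRobustDemand v Z (j k) (j (k + 1)))
    (hoff : ¬ ∃ i, 1 ≤ i ∧ i < k ∧ j (i + 1) = j (k + 1)) :
    Set.InjOn j (Set.Icc 1 (k + 1)) := by
  obtain ⟨x, hx⟩ := hM.exists_mem_of_isRobustDemand hv hP.end_unmatched hR
  have hne : ∀ i, 1 ≤ i → i ≤ k → j i ≠ j (k + 1) := by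
    intro i h1 h2 h3
    by_cases h : i = 1
    · subst h
      exact hP.start_unmatched x (h3 ▸ hx)
    · exact hoff ⟨i - 1, by omega, by omega, by rw [Nat.sub_add_cancel h1, h3]⟩
  rintro a ⟨ha, ha'⟩ b ⟨hb, hb'⟩ hab
  by_cases h1 : a = k + 1 <;> by_cases h2 : b = k + 1
  · omega
  · rw [h1] at hab
    exact absurd hab.symm (hne b hb (by omega))
  · rw [h2] at hab
    exact absurd hab (hne a ha (by omega))
  · exact hP.simple ⟨ha, by omega⟩ ⟨hb, by omega⟩ hab

theorem stateInv_improve (hv : ∀ i g, 0 ≤ v i g) {δ : ℝ} (hδ1 : δ < 1) {X Z Xh : Bundles n m}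
    {M : Finset (Fin n × Fin n)} {k : ℕ} {j : ℕ → Fin n} {c : Fin m}
    (hX : IsAllocation Finset.univ X) (hZ : RoundInv v δ X Z) (hM : IsChosenMatching v X Z M)
    (hP : IsAugmentingPath M k j) (hR : IsRobustDemand v Z (j k) (j (k + 1)))
    (hoff : ¬ ∃ i, 1 ≤ i ∧ i < k ∧ j (i + 1) = j (k + 1))
    (hc : IsLeastItem v (j k) (Z (j (k + 1))) c)
    (hlow : (2 + delta₁ δ) * val v (j (k + 1)) (removeItem Z (j (k + 1)) c (j (k + 1)))
      < val v (j (k + 1)) (X (j (k + 1))))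
    (hXh : IsReallocation X (removeItem Z (j (k + 1)) c) k j Xh) :
    StateInv v δ X (State.returnedImproved Xh) := by
  have hj := injOn_succ hv hM hP hR hoff
  have hne : ∀ i, 1 ≤ i → i ≤ k → j i ≠ j (k + 1) := fun i h1 h2 h3 => by
    have := hj ⟨h1, by omega⟩ ⟨by omega, le_rfl⟩ h3
    omega
  have hsub : ∀ b, removeItem Z (j (k + 1)) c b ⊆ X b := fun b =>
    (removeItem_subset Z _ c b).trans (hZ.subset b)
  refine ⟨hXh.isAllocation hP.one_le hj hsub hX,
    hXh.isGain hv hδ1 hP.one_le hj hsub hX ?_ ?_ hlow⟩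
  · rw [removeItem_of_ne Z c (hne 1 le_rfl hP.one_le)]
    by_contra h
    obtain ⟨i, hi⟩ := hM.1.1.2 _ h
    exact hP.start_unmatched i hi
  · intro i h1 h2
    rw [removeItem_of_ne Z c (hne i h1 h2)]
    rcases h2.lt_or_eq with h3 | rfl
    · rw [removeItem_of_ne Z c (hne (i + 1) (by omega) h3)]
      refine (hM.1.1.1.1 _ (hP.edges i h1 h3)).2 fun h => ?_
      have := hP.simple ⟨h1, h2⟩ ⟨by omega, h3⟩ h
      omega
    · rw [removeItem_self, val_erase_eq_maxDrop hc]
      exact hM.1.val_lt_maxDrop hP.end_unmatched hR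

theorem StateInv.step (hn : 0 < n) (hv : ∀ i g, 0 ≤ v i g) {δ : ℝ} (hδ1 : δ < 1)
    (hδ : delta₁ δ = 1 / n) {X : Bundles n m} (hX : IsAllocation Finset.univ X) {s s' : State n m}
    (hs : StateInv v δ X s) (h : Step v δ X s s') : StateInv v δ X s' := by
  cases h with
  | finish Z M Y hM hcard hY => exact stateInv_finish hn hv hδ hX hs hM.1.1.1 hcard hY
  | enter Z M j₁ hM hj₁ => exact ⟨hs, hM, hj₁⟩
  | modify Z M k j i hP hR hi hik hon =>
    obtain ⟨hZ, hM, hj₁⟩ := hs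
    have hmem := hP.edges i hi hik
    rw [hon] at hmem
    have hne : ∀ l, 1 ≤ l → l ≤ k → l ≠ i + 1 → j l ≠ j (k + 1) := fun l h1 h2 h3 h4 =>
      h3 (hP.simple ⟨h1, h2⟩ ⟨by omega, hik⟩ (h4.trans hon.symm))
    rw [← rematch_eq_insert_erase hM.1.1.1 hmem]
    refine ⟨hZ, hM.rematch hv hP.end_unmatched hR hmem (hne i hi hik.le (by omega)),
      fun x hx => ?_⟩
    rcases mem_rematch.1 hx with h | ⟨h, -⟩
    · exact hne 1 le_rfl hP.one_le (by omega) (congrArg Prod.snd h)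
    · exact hj₁ x h
  | improve Z M k j c Xh hP hR hoff hc hlow hXh =>
    exact stateInv_improve hv hδ1 hX hs.1 hs.2.1 hP hR hoff hc hlow hXh
  | remove Z M k j c hP hR hoff hc hhigh =>
    obtain ⟨hZ, hM, hj₁⟩ := hs
    have hj := injOn_succ hv hM hP hR hoff
    refine ⟨fun b => (removeItem_subset Z _ c b).trans (hZ.subset b), ⟨j 1, ?_⟩,
      ⟨_, hM.1.coversTouched_removeItem hv hP.end_unmatched hR hc⟩, fun b => ?_⟩
    · rw [removeItem_of_ne Z c fun h => ?_]
      · by_contra h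
        obtain ⟨i, hi⟩ := hM.1.1.2 _ h
        exact hj₁ i hi
      · have := hj ⟨le_rfl, by omega⟩ ⟨by omega, le_rfl⟩ h
        have := hP.one_le
        omega
    · by_cases hb : b = j (k + 1)
      · rw [hb]
        exact not_lt.1 hhigh
      · rw [removeItem_of_ne Z c hb]
        exact hZ.value b

/-! ### Progress and termination of an execution -/

theorem RoundInv.exists_step {δ : ℝ} {X Z : Bundles n m} (hZ : RoundInv v δ X Z) :
    ∃ s', Step v δ X (State.outer Z) s' := by
  obtain ⟨M, hM⟩ := exists_isChosenMatching hZ.covers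
  by_cases hcard : M.card = n
  · obtain ⟨σ, hσ⟩ := hM.1.1.1.exists_perm hcard
    refine ⟨_, Step.finish Z M (fun i => Z (σ i)) hM hcard fun e he => ?_⟩
    rw [hM.1.1.1.2 _ he _ (hσ e.1) (Or.inl rfl)]
  · by_contra! hno
    have hall : ∀ j, ∃ i, (i, j) ∈ M := fun j => by
      by_contra! hj
      exact hno _ (Step.enter Z M j hM hj)
    apply hcard
    have h1 : M.image Prod.snd = Finset.univ := by
      ext j
      obtain ⟨i, hi⟩ := hall j
      simpa using ⟨i, hi⟩
    rw [← Finset.card_image_of_injOn (f := Prod.snd) (s := M)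
      fun e he f hf h => hM.1.1.1.2 e he f hf (Or.inr h), h1, Finset.card_univ, Fintype.card_fin]

theorem IsChosenMatching.exists_step (hn : 0 < n) (hv : ∀ i g, 0 ≤ v i g) {δ : ℝ}
    {X Z : Bundles n m} {M : Finset (Fin n × Fin n)} {j₁ : Fin n}
    (hM : IsChosenMatching v X Z M) (hj₁ : ∀ i, (i, j₁) ∉ M) :
    ∃ s', Step v δ X (State.inner Z M j₁) s' := by
  obtain ⟨k, j₀, hP₀, rfl⟩ := exists_isAugmentingPath hM.1.1.1 hj₁
  obtain ⟨b, hb⟩ := exists_isRobustDemand hn v Z (j₀ k)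
  set j : ℕ → Fin n := Function.update j₀ (k + 1) b with hj
  have hagree : ∀ i, 1 ≤ i → i ≤ k → j i = j₀ i := fun i _ h =>
    Function.update_of_ne (show i ≠ k + 1 by omega) _ _
  have hP : IsAugmentingPath M k j := hP₀.congr hagree
  have hR : IsRobustDemand v Z (j k) (j (k + 1)) := by
    rw [hagree k hP.one_le le_rfl, hj, Function.update_self]
    exact hb
  rw [← hagree 1 le_rfl hP.one_le]
  by_cases hon : ∃ i, 1 ≤ i ∧ i < k ∧ j (i + 1) = j (k + 1)
  · obtain ⟨i, h1, h2, h3⟩ := hon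
    exact ⟨_, Step.modify Z M k j i hP hR h1 h2 h3⟩
  · obtain ⟨c, hc⟩ := exists_isLeastItem (v := v) (i := j k)
      (hM.1.robustDemand_nonempty hv hP.end_unmatched hR)
    by_cases hlow : (2 + delta₁ δ) *
        val v (j (k + 1)) (removeItem Z (j (k + 1)) c (j (k + 1))) <
          val v (j (k + 1)) (X (j (k + 1)))
    · obtain ⟨Xh, hXh⟩ := exists_isReallocation X (removeItem Z (j (k + 1)) c) hP.one_le
        (injOn_succ hv hM hP hR hon)
      exact ⟨_, Step.improve Z M k j c Xh hP hR hon hc hlow hXh⟩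
    · exact ⟨_, Step.remove Z M k j c hP hR hon hc hlow⟩

/-- A measure that decreases in every step of an execution: the number of items counts most, and
within a round the path gets shorter. -/
noncomputable def rank : State n m → ℕ
  | State.outer Z => (∑ j, (Z j).card) * (n + 2) + (n + 1)
  | State.inner Z M j₁ => (∑ j, (Z j).card) * (n + 2) + (reach M j₁).card
  | State.returnedEFX _ => 0
  | State.returnedImproved _ => 0

theorem sum_card_removeItem {Z : Bundles n m} {s : Fin n} {c : Fin m} (hc : c ∈ Z s) :
    ∑ j, (removeItem Z s c j).card + 1 = ∑ j, (Z j).card := by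
  rw [← Finset.add_sum_erase Finset.univ (fun j => (removeItem Z s c j).card) (Finset.mem_univ s),
    ← Finset.add_sum_erase Finset.univ (fun j => (Z j).card) (Finset.mem_univ s), removeItem_self,
    ← Finset.card_erase_add_one hc,
    Finset.sum_congr rfl fun j hj => by rw [removeItem_of_ne Z c (Finset.ne_of_mem_erase hj)]]
  ring

theorem StateInv.rank_lt {δ : ℝ} {X : Bundles n m} {s s' : State n m}
    (hs : StateInv v δ X s) (h : Step v δ X s s') : rank s' < rank s := by
  cases h with
  | finish Z M Y hM hcard hY => simp [rank]
  | enter Z M j₁ hM hj₁ =>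
    have := Finset.card_le_univ (reach M j₁)
    rw [Fintype.card_fin] at this
    simp only [rank]
    omega
  | modify Z M k j i hP hR hi hik hon =>
    have hM := hs.2.1.1.1.1
    rw [← hon, ← rematch_eq_insert_erase hM (hP.edges i hi hik)]
    have := Finset.card_lt_card (hP.reach_rematch_ssubset hM hi hik)
    simp only [rank]
    omega
  | improve Z M k j c Xh hP hR hoff hc hlow hXh =>
    have := Finset.card_pos.2 ⟨_, hP.mem_reach le_rfl hP.one_le⟩
    simp only [rank]
    omega
  | remove Z M k j c hP hR hoff hc hhigh =>
    have := Finset.card_pos.2 ⟨_, hP.mem_reach le_rfl hP.one_le⟩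
    simp only [rank]
    rw [← sum_card_removeItem hc.1, add_mul]
    omega

/-! ### Repeated executions -/

/-- The invariant of the repeated procedure started on `X₀`. -/
structure ConfigInv (v : Fin n → Fin m → ℝ) (δ : ℝ) (X₀ : Bundles n m) (r : Config n m) :
    Prop where
  one_le : 1 ≤ r.executions
  isAllocation : IsAllocation Finset.univ r.input
  growth : (1 + δ) ^ (r.executions - 1) * ∏ i, val v i (X₀ i) ≤ ∏ i, val v i (r.input i)
  state : StateInv v δ r.input r.state

theorem ConfigInv.step (hn : 0 < n) (hv : ∀ i g, 0 ≤ v i g) {δ : ℝ} (hδ0 : 0 ≤ δ) (hδ1 : δ < 1)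
    (hδ : delta₁ δ = 1 / n) {X₀ : Bundles n m} {r r' : Config n m} (hr : ConfigInv v δ X₀ r)
    (h : RepeatStep v δ r r') : ConfigInv v δ X₀ r' := by
  cases h with
  | inside t X s s' h =>
    exact ⟨hr.one_le, hr.isAllocation, hr.growth, hr.state.step hn hv hδ1 hδ hr.isAllocation h⟩
  | restart t X Xh =>
    obtain ⟨h1, h2, h3, h4, h5⟩ := hr
    refine ⟨Nat.le_add_left 1 t, h4, ?_, roundInv_self hn hv (by rw [hδ]; positivity) Xh⟩
    refine le_trans ?_ (h5.one_add_mul_prod_le hδ0 fun a => val_nonneg hv a _)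
    simp only at h1 h3 ⊢
    rw [Nat.add_sub_cancel, show t = t - 1 + 1 by omega, pow_succ', mul_assoc]
    exact mul_le_mul_of_nonneg_left h3 (by linarith)

theorem configInv_initial (hn : 0 < n) (hv : ∀ i g, 0 ≤ v i g) {δ : ℝ}
    (hδ : delta₁ δ = 1 / n) {X : Bundles n m} (hX : IsAllocation Finset.univ X) :
    ConfigInv v δ X (initial X) :=
  ⟨le_rfl, hX, by simp [initial], roundInv_self hn hv (by rw [hδ]; positivity) X⟩

theorem ConfigInv.exists_step (hn : 0 < n) (hv : ∀ i g, 0 ≤ v i g) {δ : ℝ}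
    {X₀ : Bundles n m} {r : Config n m} (hr : ConfigInv v δ X₀ r) :
    (∃ Y, r.state = State.returnedEFX Y) ∨ ∃ r', RepeatStep v δ r r' := by
  obtain ⟨t, X, s⟩ := r
  have hs := hr.state
  cases s with
  | outer Z =>
    obtain ⟨s', h⟩ := RoundInv.exists_step hs
    exact Or.inr ⟨_, RepeatStep.inside t X _ s' h⟩
  | inner Z M j₁ =>
    obtain ⟨s', h⟩ := hs.2.1.exists_step (δ := δ) hn hv hs.2.2
    exact Or.inr ⟨_, RepeatStep.inside t X _ s' h⟩
  | returnedEFX Y => exact Or.inl ⟨Y, rfl⟩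
  | returnedImproved Xh => exact Or.inr ⟨_, RepeatStep.restart t X Xh⟩

/-- There are finitely many families of bundles, so that the potential cannot grow forever. -/
theorem wellFounded_potential (v : Fin n → Fin m → ℝ) :
    WellFounded fun X' X : Bundles n m =>
      potential (fun a => val v a (X a)) < potential (fun a => val v a (X' a)) := by
  have : IsTrans (Bundles n m) fun X' X =>
      potential (fun a => val v a (X a)) < potential (fun a => val v a (X' a)) :=
    ⟨fun _ _ _ h h' => h'.trans h⟩
  have : Std.Irrefl (α := Bundles n m) fun X' X =>
      potential (fun a => val v a (X a)) < potential (fun a => val v a (X' a)) :=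
    ⟨fun _ => lt_irrefl _⟩
  exact Finite.wellFounded_of_trans_of_irrefl _

theorem not_exists_infinite_run (hn : 0 < n) (hv : ∀ i g, 0 ≤ v i g) {δ : ℝ} (hδ0 : 0 < δ)
    (hδ1 : δ < 1) (hδ : delta₁ δ = 1 / n) {X : Bundles n m} (hX : IsAllocation Finset.univ X) :
    ¬ ∃ r : ℕ → Config n m, r 0 = initial X ∧ ∀ t, RepeatStep v δ (r t) (r (t + 1)) := by
  rintro ⟨r, h0, hstep⟩
  have hinv : ∀ t, ConfigInv v δ X (r t) := by
    intro t
    induction t with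
    | zero =>
      rw [h0]
      exact configInv_initial hn hv hδ hX
    | succ t ih => exact ih.step hn hv hδ0.le hδ1 hδ (hstep t)
  have hwf := InvImage.wf (fun r : Config n m => (r.input, rank r.state))
    ((wellFounded_potential v).prod_lex (wellFounded_lt (α := ℕ)))
  refine (wellFounded_iff_isEmpty_descending_chain.1 hwf).false ⟨r, fun t => ?_⟩
  have hI := hinv t
  have hS := hstep t
  generalize r t = a at hI hS
  generalize r (t + 1) = b at hS
  cases hS with
  | inside t X s s' h => exact Prod.Lex.right _ (hI.state.rank_lt h)
  | restart t X Xh =>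
    exact Prod.Lex.left _ _ (hI.state.2.potential_lt hδ0 fun a => val_nonneg hv a _)

theorem ConfigInv.NW_le (hn : 0 < n) (hv : ∀ i g, 0 ≤ v i g) {δ : ℝ} (hδ0 : 0 ≤ δ)
    {X₀ : Bundles n m} {r : Config n m} (hr : ConfigInv v δ X₀ r) : NW v X₀ ≤ NW v r.input := by
  have := mul_NW_le (c := 1) (X := X₀) (Y := r.input) hn hv zero_le_one ?_
  · simpa using this
  · refine le_trans ?_ hr.growth
    exact mul_le_mul_of_nonneg_right (one_le_pow₀ (by linarith)) (prod_val_nonneg hv X₀)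

/-- Losing a factor `2 ^ n` in the product of the values costs a factor `2` in efficiency.  A negative
`ρ` is possible only if all Nash welfares are `0`, and then also that of `Y`. -/
theorem isEfficient_of_prod_le (hn : 0 < n) (hv : ∀ i g, 0 ≤ v i g) {ρ : ℝ} {X Y : Bundles n m}
    {S : Finset (Fin m)} (hY : IsAllocation S Y)
    (hX : 0 ≤ ρ → IsEfficient v ρ X) (hρ : 0 ≤ ρ ∨ opt v (Finset.univ : Finset (Fin m)) ≤ 0)
    (h : ∏ i, val v i (X i) ≤ 2 ^ n * ∏ i, val v i (Y i)) : IsEfficient v (2 * ρ) Y := by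
  unfold IsEfficient
  rcases hρ with hρ | hopt
  · have h2 : NW v X ≤ 2 * NW v Y := by
      refine le_of_pow_le_pow_left₀ hn.ne' (mul_nonneg two_pos.le (NW_nonneg hv Y)) ?_
      rwa [mul_pow, NW_pow hn hv, NW_pow hn hv]
    have := hX hρ
    unfold IsEfficient at this
    nlinarith
  · have hY0 : NW v Y = 0 := le_antisymm ((NW_le_opt_univ hn hv hY).trans hopt) (NW_nonneg hv Y)
    rw [hY0, mul_zero]
    exact hopt

/-- The Nash welfare of the input is within the factor `ρ` of the optimum, and its `n`-th power grows
by the factor `1 + δ` with `1 / log (1 + δ) ≤ (1 + δ) / δ = 2 n + 2`. -/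
theorem ConfigInv.executions_le (hn : 0 < n) (hv : ∀ i g, 0 ≤ v i g) {δ ρ : ℝ}
    (hδ : δ = 1 / (2 * (n : ℝ) + 1)) {X₀ : Bundles n m} {r : Config n m}
    (hr : ConfigInv v δ X₀ r) (hX₀ : IsAllocation Finset.univ X₀) (hρ : IsEfficient v ρ X₀)
    (hopt : 0 < opt v (Finset.univ : Finset (Fin m))) :
    (r.executions : ℝ) ≤ 4 * ρ * (n : ℝ) ^ 2 := by
  have hn1 : (1 : ℝ) ≤ n := by exact_mod_cast hn
  have hδ0 : 0 < δ := by rw [hδ]; positivity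
  unfold IsEfficient at hρ
  have h0 := NW_nonneg hv X₀
  have hle := NW_le_opt (v := v) hX₀
  have hNW : 0 < NW v X₀ := h0.lt_of_ne fun h => by
    rw [← h, mul_zero] at hρ
    linarith
  have hρ1 : 1 ≤ ρ := by
    by_contra! h
    nlinarith
  have hpow : (1 + δ) ^ (r.executions - 1) ≤ ρ ^ n := by
    have h1 : NW v r.input ^ n ≤ (ρ * NW v X₀) ^ n :=
      pow_le_pow_left₀ (NW_nonneg hv _) ((NW_le_opt hr.isAllocation).trans hρ) n
    rw [mul_pow, NW_pow hn hv] at h1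
    have h2 := hr.growth
    rw [← NW_pow hn hv X₀] at h2
    exact le_of_mul_le_mul_right (h2.trans h1) (pow_pos hNW n)
  have hlog := Real.log_le_log (by positivity) hpow
  rw [Real.log_pow, Real.log_pow, Nat.cast_sub hr.one_le, Nat.cast_one] at hlog
  have hl1 : Real.log ρ ≤ ρ - 1 := Real.log_le_sub_one_of_pos (by linarith)
  have hl2 : 1 / (2 * (n : ℝ) + 2) ≤ Real.log (1 + δ) := by
    have h := Real.one_sub_inv_le_log_of_pos (x := 1 + δ) (by positivity)
    have h' : 1 - (1 + δ)⁻¹ = 1 / (2 * (n : ℝ) + 2) := by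
      rw [hδ]
      field_simp
      ring
    rwa [h'] at h
  have ht : (0 : ℝ) ≤ (r.executions : ℝ) - 1 := by
    have : (1 : ℝ) ≤ r.executions := by exact_mod_cast hr.one_le
    linarith
  have h1 : ((r.executions : ℝ) - 1) * (1 / (2 * (n : ℝ) + 2)) ≤ n * (ρ - 1) :=
    (mul_le_mul_of_nonneg_left hl2 ht).trans
      (hlog.trans (mul_le_mul_of_nonneg_left hl1 (by linarith)))
  rw [mul_one_div, div_le_iff₀ (by positivity)] at h1
  have h2 : (n : ℝ) * (ρ - 1) * (2 * n + 2) ≤ n * (ρ - 1) * (4 * n) :=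
    mul_le_mul_of_nonneg_left (by linarith) (mul_nonneg (by linarith) (by linarith))
  nlinarith

end FairDivision

/-- Suboptimal input allocation.  Every run of the repeated procedure is finite, it never gets
stuck before an execution returns an EFX allocation, every improved allocation on the way is an
allocation of all items whose Nash welfare is larger by the factor `(1 + δ) ^ (1 / n)`, the
returned EFX allocation is `2ρ`-efficient, and there are `O(ρ n²)` executions (if some allocation
has positive Nash welfare). -/
theorem theorem3 :
    ∃ C : ℝ, ∀ (n m : ℕ) (v : Fin n → Fin m → ℝ) (ρ : ℝ) (X : FairDivision.Bundles n m),
      0 < n → (∀ i g, 0 ≤ v i g) →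
      FairDivision.IsAllocation Finset.univ X →
      FairDivision.IsEfficient v ρ X →
      ∀ δ : ℝ, δ = 1 / (2 * (n : ℝ) + 1) →
        (¬ ∃ r : ℕ → FairDivision.Config n m, r 0 = FairDivision.initial X ∧
          ∀ t, FairDivision.RepeatStep v δ (r t) (r (t + 1))) ∧
        ∀ r : FairDivision.Config n m, FairDivision.Reachable v δ X r →
          ((∃ Y, r.state = FairDivision.State.returnedEFX Y) ∨
            ∃ r', FairDivision.RepeatStep v δ r r') ∧
          (∀ Xh, r.state = FairDivision.State.returnedImproved Xh →
            FairDivision.IsAllocation Finset.univ Xh ∧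
            (1 + δ) ^ ((1 : ℝ) / n) * FairDivision.NW v r.input ≤ FairDivision.NW v Xh) ∧
          (∀ Y, r.state = FairDivision.State.returnedEFX Y →
            (∃ S : Finset (Fin m), FairDivision.IsAllocation S Y) ∧
            FairDivision.IsEFX v Y ∧
            FairDivision.IsEfficient v (2 * ρ) Y) ∧
          (0 < FairDivision.opt v (Finset.univ : Finset (Fin m)) →
            (r.executions : ℝ) ≤ C * ρ * (n : ℝ) ^ 2) := by

  refine ⟨4, fun n m v ρ X hn hv hX hρ δ hδ => ?_⟩
  have hn1 : (1 : ℝ) ≤ n := by exact_mod_cast hn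
  have hδ0 : 0 < δ := by
    rw [hδ]
    positivity
  have hδ1 : δ < 1 := by
    rw [hδ, div_lt_one (by positivity)]
    linarith
  have hd : FairDivision.delta₁ δ = 1 / n := by
    have h1 : 1 - δ = 2 * n / (2 * n + 1) := by
      rw [hδ]
      field_simp
      ring
    rw [FairDivision.delta₁, h1, hδ]
    field_simp
  refine ⟨FairDivision.not_exists_infinite_run hn hv hδ0 hδ1 hd hX, fun r hr => ?_⟩
  have hI : FairDivision.ConfigInv v δ X r := by
    induction hr with
    | refl => exact FairDivision.configInv_initial hn hv hd hX
    | tail _ h ih => exact ih.step hn hv hδ0.le hδ1 hd h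
  refine ⟨hI.exists_step hn hv, fun Xh h => ?_, fun Y h => ?_, hI.executions_le hn hv hδ hX hρ⟩
  · have hs := hI.state
    rw [h] at hs
    exact ⟨hs.1, FairDivision.mul_NW_le hn hv (by linarith)
      (hs.2.one_add_mul_prod_le hδ0.le fun a => FairDivision.val_nonneg hv a _)⟩
  · have hs := hI.state
    rw [h] at hs
    obtain ⟨⟨S, hS⟩, hefx, hprod⟩ := hs
    refine ⟨⟨S, hS⟩, hefx, FairDivision.isEfficient_of_prod_le hn hv hS (fun h0 => ?_)
      (hρ.nonneg_or hv) hprod⟩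
    exact hρ.trans (mul_le_mul_of_nonneg_left (hI.NW_le hn hv hδ0.le) h0)
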